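/- **Theorem 1.1.** Let $S$ be a semigroup and let $T$ be a subsemigroup of $S$ such that the set $S\setminus T$ is finite. If $S$ has a finite complete rewriting system, then so does $T$. Here, for a set $A$, $A^+$ denotes the free semigroup of all nonempty words over $A$, and $A^*=A^+\cup\{\epsilon\}$ the free monoid. A rewriting system $R$ over $A$ is a subset of $A^+\times A^+$, whose elements are written $X\to Y$. One writes $W_1\to_R W_2$ if $W_1=Z_1XZ_2$ and $W_2=Z_1YZ_2$ for some rule $X\to Y$ in $R$ and some $Z_1,Z_2\in A^*$, and $\to_R^*$ denotes the reflexive transitive closure of $\to_R$ on $A^+$. The system $R$ is complete if it is Noetherian (there is no infinite sequence $W_1\to_R W_2\to_R W_3\to_R\cdots$) and confluent (whenever $U\to_R^*V$ and $U\to_R^*W$, there is $X\in A^+$ with $V\to_R^*X$ and $W\to_R^*X$). A semigroup has a finite complete rewriting system if there are a finite set $A$ and a finite complete rewriting system $R$ over $A$ such that the semigroup is isomorphic to the quotient of $A^+$ by the congruence generated by $R$. -/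

import Mathlib

namespace StringRewriting

variable {α : Type*}

/-- The letters of a nonempty word, i.e. the inclusion of the free semigroup `A⁺` in the free
monoid `A*` of all finite words. -/
def letters (w : FreeSemigroup α) : List α := w.head :: w.tail

theorem letters_injective : Function.Injective (letters (α := α)) := by
  rintro ⟨a, l⟩ ⟨b, m⟩ h
  simp only [letters, List.cons.injEq] at h
  obtain ⟨rfl, rfl⟩ := h
  rfl

theorem letters_mul (v w : FreeSemigroup α) : letters (v * w) = letters v ++ letters w := by
  simp [letters]

/-- A rewriting system over the alphabet `α`: a set of rules `X → Y`, i.e. of pairs `(X, Y)` of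
nonempty words. -/
abbrev RewritingSystem (α : Type*) := Set (FreeSemigroup α × FreeSemigroup α)

namespace RewritingSystem

/-- One-step reduction: `W₁ = Z₁ X Z₂` and `W₂ = Z₁ Y Z₂` for some rule `X → Y` and some possibly
empty words `Z₁`, `Z₂`. -/
def Step (R : RewritingSystem α) (W₁ W₂ : FreeSemigroup α) : Prop :=
  ∃ X Y : FreeSemigroup α, (X, Y) ∈ R ∧ ∃ Z₁ Z₂ : List α,
    letters W₁ = Z₁ ++ letters X ++ Z₂ ∧ letters W₂ = Z₁ ++ letters Y ++ Z₂

/-- The reflexive transitive closure of one-step reduction. -/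
def Reduces (R : RewritingSystem α) : FreeSemigroup α → FreeSemigroup α → Prop :=
  Relation.ReflTransGen R.Step

/-- There is no infinite reduction sequence `W₀ → W₁ → W₂ → ⋯`. -/
def Noetherian (R : RewritingSystem α) : Prop :=
  ¬ ∃ W : ℕ → FreeSemigroup α, ∀ n, R.Step (W n) (W (n + 1))

/-- Two reducts of one word have a common reduct. -/
def Confluent (R : RewritingSystem α) : Prop :=
  ∀ U V W : FreeSemigroup α, R.Reduces U V → R.Reduces U W →
    ∃ X : FreeSemigroup α, R.Reduces V X ∧ R.Reduces W X

/-- A rewriting system is complete if it is Noetherian and confluent. -/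
def Complete (R : RewritingSystem α) : Prop := R.Noetherian ∧ R.Confluent

/-- The congruence on the free semigroup generated by the rules. -/
def congruence (R : RewritingSystem α) : Con (FreeSemigroup α) :=
  conGen fun X Y => (X, Y) ∈ R

/-- `S` is presented by `[α; R]`: it is isomorphic to the quotient of the free semigroup on `α`
by the congruence generated by `R`. -/
def Presents (R : RewritingSystem α) (S : Type*) [Semigroup S] : Prop :=
  Nonempty (R.congruence.Quotient ≃* S)

end RewritingSystem

/-- `S` has a presentation `[A; R]` with `A` and `R` finite and `R` complete. A finite alphabet can
be taken in `Type` without loss of generality. If `S` is nonempty, then the alphabet is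
automatically nonempty; the empty alphabet only presents the empty semigroup. -/
def HasFiniteCompleteRewritingSystem (S : Type*) [Semigroup S] : Prop :=
  ∃ (A : Type) (R : RewritingSystem A), Finite A ∧ R.Finite ∧ R.Complete ∧ R.Presents S

end StringRewriting

namespace StringRewriting

/-! ### Words, contexts and evaluation. -/

variable {α : Type*}

/-! Irreducible words over $A$ are normal forms for $S$, so only finitely many represent elements
outside $T$. Hence some $K>0$ is such that every irreducible word of length at least $K$ lies in $T$
(`exists_length_bound`). The new alphabet consists of the irreducible words in $T$ of length at most
$2K$, called blocks. Cutting off $K$ letters at a time spells every normal form in $T$ by blocks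
(`exists_spell_eq`).

The rules over blocks simulate $R$ on short words, merge two blocks into one, or shift letters
leftwards across a boundary. Each step reduces the spelled word by $R$, or fixes it and lowers
`suffixWeight`; this gives termination. An irreducible block word spells an $R$-irreducible word and
is its only irreducible factorisation: all blocks but the last two have length $2K$, and the last
cut is as far right as possible (`eq_of_flatten_eq_of_isChain`). Irreducible block words thus
represent distinct elements of $T$, and confluence follows. -/

theorem letters_ne_nil (w : FreeSemigroup α) : letters w ≠ [] := by simp [letters]

theorem letters_length_pos (w : FreeSemigroup α) : 0 < (letters w).length := by simp [letters]

theorem letters_of (a : α) : letters (FreeSemigroup.of a) = [a] := rfl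

theorem exists_letters_eq {l : List α} (h : l ≠ []) : ∃ w, letters w = l := by
  cases l with
  | nil => exact absurd rfl h
  | cons a l => exact ⟨⟨a, l⟩, rfl⟩

theorem exists_letters_eq_context (P Q : List α) (u : FreeSemigroup α) :
    ∃ w, letters w = P ++ letters u ++ Q :=
  exists_letters_eq (by simp [letters_ne_nil])

/-- Adjoining an identity gives empty contexts a value. -/
theorem coe_map_eq_prod {S : Type*} [Semigroup S] (φ : FreeSemigroup α →ₙ* S)
    (u : FreeSemigroup α) :
    (φ u : WithOne S) =
      ((letters u).map fun a => (φ (FreeSemigroup.of a) : WithOne S)).prod := by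
  induction u using FreeSemigroup.recOnMul with
  | ih1 a => simp [letters_of]
  | ih2 a v h1 h2 => rw [map_mul, WithOne.coe_mul, h1, h2, letters_mul, List.map_append,
      List.prod_append]

theorem map_eq_map_of_context {S : Type*} [Semigroup S] (φ : FreeSemigroup α →ₙ* S)
    {X Y U V : FreeSemigroup α} {P Q : List α} (h : φ X = φ Y)
    (hU : letters U = P ++ letters X ++ Q) (hV : letters V = P ++ letters Y ++ Q) :
    φ U = φ V := by
  apply WithOne.coe_injective
  rw [coe_map_eq_prod, coe_map_eq_prod, hU, hV]
  simp only [List.map_append, List.prod_append]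
  rw [← coe_map_eq_prod, ← coe_map_eq_prod, h]

theorem finite_setOf_letters_length_le [Finite α] (n : ℕ) :
    {w : FreeSemigroup α | (letters w).length ≤ n}.Finite :=
  (List.finite_length_le α n).preimage letters_injective.injOn

/-! ### Normal forms and complete presentations. -/

namespace RewritingSystem

variable {R : RewritingSystem α}

/-- A word to which no rule applies. -/
def IsIrreducible (R : RewritingSystem α) (u : FreeSemigroup α) : Prop := ∀ v, ¬ R.Step u v

theorem Step.context {X Y U V : FreeSemigroup α} {P Q : List α} (h : R.Step X Y)
    (hU : letters U = P ++ letters X ++ Q) (hV : letters V = P ++ letters Y ++ Q) :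
    R.Step U V := by
  obtain ⟨x, y, hxy, Z₁, Z₂, hX, hY⟩ := h
  exact ⟨x, y, hxy, P ++ Z₁, Z₂ ++ Q, by simp [hU, hX], by simp [hV, hY]⟩

theorem Reduces.context {X Y : FreeSemigroup α} {P Q : List α} (h : R.Reduces X Y)
    {U V : FreeSemigroup α}
    (hU : letters U = P ++ letters X ++ Q) (hV : letters V = P ++ letters Y ++ Q) :
    R.Reduces U V := by
  induction h generalizing V with
  | refl =>
    obtain rfl : U = V := letters_injective (hU.trans hV.symm)
    exact Relation.ReflTransGen.refl
  | @tail Y₁ Y₂ _ hs ih =>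
    obtain ⟨W, hW⟩ := exists_letters_eq_context P Q Y₁
    exact (ih hW).tail (hs.context hW hV)

theorem step_of_mem {X Y : FreeSemigroup α} (h : (X, Y) ∈ R) : R.Step X Y :=
  ⟨X, Y, h, [], [], by simp, by simp⟩

theorem IsIrreducible.of_infix {u v : FreeSemigroup α} (hu : R.IsIrreducible u)
    (h : letters v <:+: letters u) : R.IsIrreducible v := by
  obtain ⟨P, Q, h⟩ := h
  intro w hw
  obtain ⟨W, hW⟩ := exists_letters_eq_context P Q w
  exact hu W (hw.context h.symm hW)

theorem IsIrreducible.eq_of_reduces {u v : FreeSemigroup α} (hu : R.IsIrreducible u)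
    (h : R.Reduces u v) : u = v := by
  rcases Relation.ReflTransGen.cases_head h with h | ⟨w, hw, -⟩
  · exact h
  · exact absurd hw (hu w)

theorem noetherian_iff_wellFounded : R.Noetherian ↔ WellFounded (Function.swap R.Step) := by
  rw [wellFounded_iff_isEmpty_descending_chain, isEmpty_subtype, Noetherian, not_exists]

theorem Noetherian.exists_irreducible (h : R.Noetherian) (u : FreeSemigroup α) :
    ∃ v, R.Reduces u v ∧ R.IsIrreducible v := by
  induction u using (noetherian_iff_wellFounded.1 h).induction with
  | _ u ih =>
    by_cases hu : R.IsIrreducible u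
    · exact ⟨u, Relation.ReflTransGen.refl, hu⟩
    · simp only [IsIrreducible, not_forall, not_not] at hu
      obtain ⟨v, hv⟩ := hu
      obtain ⟨w, hvw, hw⟩ := ih v hv
      exact ⟨w, hvw.head hv, hw⟩

theorem map_eq_of_reduces {S : Type*} [Semigroup S] {φ : FreeSemigroup α →ₙ* S}
    (hφ : ∀ X Y, (X, Y) ∈ R → φ X = φ Y) {u v : FreeSemigroup α} (h : R.Reduces u v) :
    φ u = φ v := by
  induction h with
  | refl => rfl
  | tail _ hs ih =>
    obtain ⟨X, Y, hXY, Z₁, Z₂, h₁, h₂⟩ := hs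
    exact ih.trans (map_eq_map_of_context φ (hφ X Y hXY) h₁ h₂)

theorem congruence_of_reduces {u v : FreeSemigroup α} (h : R.Reduces u v) :
    R.congruence u v := by
  have := map_eq_of_reduces (R := R) (φ := R.congruence.mkMulHom)
    (fun X Y hXY => (Con.eq _).2 (ConGen.Rel.of _ _ hXY)) h
  exact (Con.eq _).1 this

/-- The Church–Rosser property; confluence is needed only for transitivity. -/
theorem Confluent.join_of_congruence (hR : R.Confluent) {u v : FreeSemigroup α}
    (h : R.congruence u v) : ∃ w, R.Reduces u w ∧ R.Reduces v w := by
  change ConGen.Rel _ u v at h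
  induction h with
  | of x y h => exact ⟨y, Relation.ReflTransGen.single (step_of_mem h), Relation.ReflTransGen.refl⟩
  | refl x => exact ⟨x, Relation.ReflTransGen.refl, Relation.ReflTransGen.refl⟩
  | symm _ ih =>
    obtain ⟨w, h₁, h₂⟩ := ih
    exact ⟨w, h₂, h₁⟩
  | trans _ _ ih₁ ih₂ =>
    obtain ⟨w₁, h₁, h₂⟩ := ih₁
    obtain ⟨w₂, h₃, h₄⟩ := ih₂
    obtain ⟨w, h₅, h₆⟩ := hR _ _ _ h₂ h₃
    exact ⟨w, h₁.trans h₅, h₄.trans h₆⟩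
  | mul _ _ ih₁ ih₂ =>
    have key {a b c d : FreeSemigroup α} (h₁ : R.Reduces a b) (h₂ : R.Reduces c d) :
        R.Reduces (a * c) (b * d) :=
      Relation.ReflTransGen.trans
        (h₁.context (P := []) (Q := letters c) (by simp [letters_mul]) (letters_mul b c))
        (h₂.context (P := letters b) (Q := []) (by simp [letters_mul]) (by simp [letters_mul]))
    obtain ⟨w₁, h₁, h₂⟩ := ih₁
    obtain ⟨w₂, h₃, h₄⟩ := ih₂
    exact ⟨w₁ * w₂, key h₁ h₃, key h₂ h₄⟩

/-- A complete presentation yields a surjective evaluation homomorphism that is injective on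
irreducible words. -/
theorem Presents.exists_evaluation {S : Type*} [Semigroup S] (hS : R.Presents S)
    (hR : R.Confluent) :
    ∃ φ : FreeSemigroup α →ₙ* S, Function.Surjective φ ∧ (∀ X Y, (X, Y) ∈ R → φ X = φ Y) ∧
      Set.InjOn φ {u | R.IsIrreducible u} := by
  obtain ⟨e⟩ := hS
  refine ⟨(e : R.congruence.Quotient →ₙ* S).comp R.congruence.mkMulHom, ?_, ?_, ?_⟩
  · exact e.surjective.comp Quotient.mk_surjective
  · intro X Y hXY
    exact congrArg e ((Con.eq _).2 (ConGen.Rel.of _ _ hXY))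
  · intro u hu v hv h
    obtain ⟨w, huw, hvw⟩ := hR.join_of_congruence ((Con.eq _).1 (e.injective h))
    rw [IsIrreducible.eq_of_reduces hu huw, IsIrreducible.eq_of_reduces hv hvw]

/-- A Noetherian system whose irreducible words represent distinct elements is a complete
presentation. -/
theorem Noetherian.complete_and_presents {S : Type*} [Semigroup S] (hR : R.Noetherian)
    {φ : FreeSemigroup α →ₙ* S} (hφ : Function.Surjective φ)
    (hrel : ∀ X Y, (X, Y) ∈ R → φ X = φ Y) (hinj : Set.InjOn φ {u | R.IsIrreducible u}) :
    R.Complete ∧ R.Presents S := by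
  -- Words of equal value have irreducible reducts of equal value, which coincide by injectivity.
  have join {u v : FreeSemigroup α} (h : φ u = φ v) :
      ∃ w, R.Reduces u w ∧ R.Reduces v w := by
    obtain ⟨u', hu, hu'⟩ := hR.exists_irreducible u
    obtain ⟨v', hv, hv'⟩ := hR.exists_irreducible v
    obtain rfl : u' = v' := hinj hu' hv'
      ((map_eq_of_reduces hrel hu).symm.trans (h.trans (map_eq_of_reduces hrel hv)))
    exact ⟨u', hu, hv⟩
  refine ⟨⟨hR, fun U V W hV hW => join
    ((map_eq_of_reduces hrel hV).symm.trans (map_eq_of_reduces hrel hW))⟩, ?_⟩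
  have hker {u v : FreeSemigroup α} : R.congruence u v ↔ φ u = φ v := by
    constructor
    · intro h
      change ConGen.Rel _ u v at h
      induction h with
      | of x y h => exact hrel x y h
      | refl x => rfl
      | symm _ ih => exact ih.symm
      | trans _ _ ih₁ ih₂ => exact ih₁.trans ih₂
      | mul _ _ ih₁ ih₂ => rw [map_mul, map_mul, ih₁, ih₂]
    · intro h
      obtain ⟨w, hu, hv⟩ := join h
      exact R.congruence.trans (congruence_of_reduces hu)
        (R.congruence.symm (congruence_of_reduces hv))
  let f : R.congruence.Quotient → S := Quotient.lift φ fun _ _ h => hker.1 h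
  have hf : Function.Bijective f := by
    constructor
    · rintro ⟨u⟩ ⟨v⟩ h
      exact (Con.eq _).2 (hker.2 h)
    · intro s
      obtain ⟨u, rfl⟩ := hφ s
      exact ⟨(u : R.congruence.Quotient), rfl⟩
  refine ⟨{ Equiv.ofBijective f hf with map_mul' := ?_ }⟩
  rintro ⟨u⟩ ⟨v⟩
  exact map_mul φ u v

end RewritingSystem

/-! ### Combinatorics of factorisations. -/

/-- A factor of a concatenation of nonempty words is contained in the concatenation of few
consecutive words. -/
theorem exists_short_infix_of_flatten_eq (L : List (List α)) (hL : ∀ l ∈ L, l ≠ [])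
    (z₁ x z₂ : List α) (h : L.flatten = z₁ ++ x ++ z₂) :
    ∃ P C Q, L = P ++ C ++ Q ∧ C.length ≤ x.length + 1 ∧ x <:+: C.flatten := by
  induction L generalizing z₁ with
  | nil => exact ⟨[], [], [], by simp_all⟩
  | cons b L ih =>
    rcases le_or_gt b.length z₁.length with hb | hb
    · obtain ⟨z, rfl⟩ : b <+: z₁ := List.prefix_of_prefix_length_le
        (l₃ := (b :: L).flatten) ⟨_, rfl⟩ ⟨x ++ z₂, by simp [h]⟩ hb
      obtain ⟨P, C, Q, rfl, hC, hx⟩ := ih (fun l hl => hL l (by simp [hl])) z (by simpa using h)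
      exact ⟨b :: P, C, Q, by simp, hC, hx⟩
    -- Here `z₁` ends inside `b`, and each later word contributes at least one letter, so `b` and
    -- the next `x.length` words cover `x`.
    · refine ⟨[], b :: L.take x.length, L.drop x.length, by simp, by simp, ?_⟩
      have hlen (k : ℕ) : L.take k = L ∨ k ≤ (L.take k).flatten.length := by
        rcases le_total L.length k with hk | hk
        · exact .inl (List.take_of_length_le hk)
        · right
          rw [List.length_flatten]
          have := List.length_le_sum_of_one_le ((L.take k).map List.length) (by
            intro i hi
            obtain ⟨l, hl, rfl⟩ := List.mem_map.1 hi
            exact List.length_pos_iff.2 (hL l (by simp [List.mem_of_mem_take hl])))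
          simpa [hk] using this
      rcases hlen x.length with hk | hk
      · exact ⟨z₁, z₂, by rw [hk, h]⟩
      · have : z₁ ++ x <+: (b :: L.take x.length).flatten := by
          refine List.prefix_of_prefix_length_le (l₃ := (b :: L).flatten) ⟨z₂, h.symm⟩
            ⟨(L.drop x.length).flatten, ?_⟩ ?_
          · simp [← List.flatten_append]
          · simp only [List.flatten_cons, List.length_append]
            omega
        obtain ⟨q, hq⟩ := this
        exact ⟨z₁, q, hq⟩

/-- The sum of the lengths of the concatenations of all proper suffixes of a list of words. -/
def suffixWeight : List (List α) → ℕ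
  | [] => 0
  | _ :: L => L.flatten.length + suffixWeight L

/-- Words of `P` see only the total length of what follows, which is the same on both sides. -/
theorem suffixWeight_append_lt (P : List (List α)) {C D : List (List α)}
    (hlen : C.flatten.length = D.flatten.length) (h : suffixWeight C < suffixWeight D) :
    suffixWeight (P ++ C) < suffixWeight (P ++ D) := by
  induction P with
  | nil => exact h
  | cons p P ih =>
    simp only [List.cons_append, suffixWeight, List.flatten_append, List.length_append]
    omega

/-- Adjacent members `b`, `c` of a list of words of length at most `2 * K` from `D`, to which no
shift of letters from the second word to the first can be applied. -/
def Adjacent (D : Set (List α)) (K : ℕ) (b c : List α) : Prop :=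
  2 * K < b.length + c.length ∧ (b.length = 2 * K ∨ c.length ≤ K) ∧
    ∀ d ∈ D, ∀ e ∈ D, b ++ c = d ++ e → c.length ≤ e.length

/-- Words followed by at least two others have length `2 * K`, so they can be cancelled from the
left. Length excludes different numbers of words at the end, and minimality of the last word settles
a final pair. -/
theorem eq_of_flatten_eq_of_isChain {D : Set (List α)} {K : ℕ}
    (hD : ∀ d ∈ D, 0 < d.length ∧ d.length ≤ 2 * K) :
    ∀ {L L' : List (List α)}, (∀ l ∈ L, l ∈ D) → (∀ l ∈ L', l ∈ D) →
      L.IsChain (Adjacent D K) → L'.IsChain (Adjacent D K) → L.flatten = L'.flatten → L = L'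
  | [], [], _, _, _, _, _ => rfl
  | [], b :: L, _, hL, _, _, h => by
    have := hD b (hL b (by simp))
    have := congrArg List.length h
    simp at this
    omega
  | b :: L, [], hL, _, _, _, h => by
    have := hD b (hL b (by simp))
    have := congrArg List.length h
    simp only [List.flatten_cons, List.length_append, List.flatten_nil, List.length_nil] at this
    omega
  | [b], [c], _, _, _, _, h => by simpa using h
  | [b], c :: d :: L, hb, _, _, hc, h => by
    have := (hD b (hb b (by simp))).2
    have := (List.isChain_cons_cons.1 hc).1.1
    have := congrArg List.length h
    simp at this
    omega
  | c :: d :: L, [b], _, hb, hc, _, h => by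
    have := (hD b (hb b (by simp))).2
    have := (List.isChain_cons_cons.1 hc).1.1
    have := congrArg List.length h
    simp at this
    omega
  | [b, c], [d, e], h₁, h₂, hc, hc', h => by
    have h' : b ++ c = d ++ e := by simpa using h
    have h₃ := (List.isChain_cons_cons.1 hc).1.2.2 d (h₂ d (by simp)) e (h₂ e (by simp)) h'
    have h₄ := (List.isChain_cons_cons.1 hc').1.2.2 b (h₁ b (by simp)) c (h₁ c (by simp)) h'.symm
    obtain ⟨rfl, rfl⟩ := List.append_inj' h' (le_antisymm h₃ h₄)
    rfl
  | [b, c], d :: e :: f :: L, h₁, h₂, _, hc, h => by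
    have := (hD b (h₁ b (by simp))).2
    have := (hD c (h₁ c (by simp))).2
    have := length_eq_of_isChain hD h₂ hc
    have := (List.isChain_cons_cons.1 (List.isChain_cons_cons.1 hc).2).1.1
    have := congrArg List.length h
    simp at this
    omega
  | d :: e :: f :: L, [b, c], h₂, h₁, hc, _, h => by
    have := (hD b (h₁ b (by simp))).2
    have := (hD c (h₁ c (by simp))).2
    have := length_eq_of_isChain hD h₂ hc
    have := (List.isChain_cons_cons.1 (List.isChain_cons_cons.1 hc).2).1.1
    have := congrArg List.length h
    simp at this
    omega
  | a :: b :: c :: L, d :: e :: f :: L', h₁, h₂, hc, hc', h => by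
    have h₃ := length_eq_of_isChain hD h₁ hc
    have h₄ := length_eq_of_isChain hD h₂ hc'
    rw [List.flatten_cons, List.flatten_cons (l := d)] at h
    obtain ⟨rfl, h'⟩ := List.append_inj h (h₃.trans h₄.symm)
    rw [eq_of_flatten_eq_of_isChain hD (fun l hl => h₁ l (List.mem_cons_of_mem _ hl))
      (fun l hl => h₂ l (List.mem_cons_of_mem _ hl)) (List.isChain_cons_cons.1 hc).2
      (List.isChain_cons_cons.1 hc').2 h']
where
  -- Otherwise `c` has length at most `K`, so it is not of length `2 * K` and `d` also has length at
  -- most `K`. Then `c` and `d` together are too short.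
  length_eq_of_isChain {D : Set (List α)} {K : ℕ}
      (hD : ∀ d ∈ D, 0 < d.length ∧ d.length ≤ 2 * K) {b c d : List α} {L : List (List α)}
      (hL : ∀ l ∈ b :: c :: d :: L, l ∈ D) (h : (b :: c :: d :: L).IsChain (Adjacent D K)) :
      b.length = 2 * K := by
    have h₁ := (List.isChain_cons_cons.1 h).1.2.1
    obtain ⟨h₂, h₃, -⟩ := (List.isChain_cons_cons.1 (List.isChain_cons_cons.1 h).2).1
    have := hD c (hL c (by simp))
    omega

/-! ### Rewriting over an alphabet of words. -/

section Blocks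

variable {B : Set (FreeSemigroup α)}

/-- The words over `α` that are the letters of a word over `B`. -/
def factors (β : FreeSemigroup B) : List (List α) := (letters β).map fun b => letters b.1

theorem factors_injective : Function.Injective (factors (B := B)) :=
  (List.map_injective_iff.2 (letters_injective.comp Subtype.val_injective)).comp letters_injective

/-- The word over `α` spelled by a word over a set `B` of words over `α`. -/
def spell : FreeSemigroup B →ₙ* FreeSemigroup α := FreeSemigroup.lift Subtype.val

theorem spell_of (b : B) : spell (FreeSemigroup.of b) = b.1 := FreeSemigroup.lift_of _ _

theorem letters_spell (β : FreeSemigroup B) : letters (spell β) = (factors β).flatten := by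
  induction β using FreeSemigroup.recOnMul with
  | ih1 b => simp [spell_of, factors, letters_of]
  | ih2 b β h₁ h₂ => rw [map_mul, letters_mul, h₁, h₂]; simp [factors, letters_mul]

theorem mem_of_mem_factors {β : FreeSemigroup B} {l : List α} (h : l ∈ factors β) :
    ∃ b : B, b ∈ letters β ∧ letters b.1 = l := by
  simpa [factors] using h

theorem factors_of_context {β γ : FreeSemigroup B} {P Q : List B}
    (h : letters β = P ++ letters γ ++ Q) :
    factors β = P.map (fun b => letters b.1) ++ factors γ ++ Q.map (fun b => letters b.1) := by
  simp [factors, h]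

namespace RewritingSystem

/-- The rewriting system over a set `B` of words that rewrites by `f` the words over `B` of length
at most `n` that spell a reducible word, merges adjacent letters, and shifts letters to the left. -/
def blockSystem (R : RewritingSystem α) (n : ℕ) (f : FreeSemigroup B → FreeSemigroup B) :
    RewritingSystem B :=
  {p | (letters p.1).length ≤ n ∧ ¬ R.IsIrreducible (spell p.1) ∧ p.2 = f p.1} ∪
  ({p | ∃ b c d : B, p = (FreeSemigroup.of b * FreeSemigroup.of c, FreeSemigroup.of d) ∧
    b.1 * c.1 = d.1} ∪
  {p | ∃ b c d e : B, p = (FreeSemigroup.of b * FreeSemigroup.of c,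
      FreeSemigroup.of d * FreeSemigroup.of e) ∧
    b.1 * c.1 = d.1 * e.1 ∧ (letters e.1).length < (letters c.1).length})

variable {R : RewritingSystem α} {n : ℕ} {f : FreeSemigroup B → FreeSemigroup B}

theorem blockSystem_finite [Finite B] : (R.blockSystem n f).Finite := by
  refine .union ?_ (.union ?_ ?_)
  · refine ((finite_setOf_letters_length_le (α := B) n).image fun γ => (γ, f γ)).subset ?_
    rintro ⟨γ, δ⟩ ⟨h, -, hδ⟩
    exact ⟨γ, h, Prod.ext rfl hδ.symm⟩
  · refine (Set.finite_range fun p : B × B × B =>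
      (FreeSemigroup.of p.1 * FreeSemigroup.of p.2.1, FreeSemigroup.of p.2.2)).subset ?_
    rintro _ ⟨b, c, d, rfl, -⟩
    exact ⟨(b, c, d), rfl⟩
  · refine (Set.finite_range fun p : B × B × B × B =>
      (FreeSemigroup.of p.1 * FreeSemigroup.of p.2.1,
        FreeSemigroup.of p.2.2.1 * FreeSemigroup.of p.2.2.2)).subset ?_
    rintro _ ⟨b, c, d, e, rfl, -⟩
    exact ⟨(b, c, d, e), rfl⟩

theorem blockSystem_reduces_spell (hf : ∀ γ, R.Reduces (spell γ) (spell (f γ)))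
    {X Y : FreeSemigroup B} (h : (X, Y) ∈ R.blockSystem n f) :
    R.Reduces (spell X) (spell Y) := by
  rcases h with ⟨-, -, h⟩ | ⟨b, c, d, h, hs⟩ | ⟨b, c, d, e, h, hs, -⟩
  · obtain rfl : Y = f X := h
    exact hf X
  · obtain ⟨rfl, rfl⟩ := Prod.mk.inj h
    rw [map_mul, spell_of, spell_of, spell_of, hs]
    exact Relation.ReflTransGen.refl
  · obtain ⟨rfl, rfl⟩ := Prod.mk.inj h
    rw [map_mul, map_mul, spell_of, spell_of, spell_of, spell_of, hs]
    exact Relation.ReflTransGen.refl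

/-- The two alternatives give a lexicographic descent. -/
theorem blockSystem_step (hf : ∀ γ, R.Reduces (spell γ) (spell (f γ)))
    (hirr : ∀ γ, R.IsIrreducible (spell (f γ)))
    {β β' : FreeSemigroup B} (h : (R.blockSystem n f).Step β β') :
    Relation.TransGen R.Step (spell β) (spell β') ∨
      spell β = spell β' ∧ suffixWeight (factors β') < suffixWeight (factors β) := by
  obtain ⟨X, Y, hXY, P, Q, h₁, h₂⟩ := h
  have hX : letters (spell β) = (P.map fun b => letters b.1).flatten ++ letters (spell X) ++
      (Q.map fun b => letters b.1).flatten := by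
    rw [letters_spell, letters_spell, factors_of_context h₁]; simp
  have hY : letters (spell β') = (P.map fun b => letters b.1).flatten ++ letters (spell Y) ++
      (Q.map fun b => letters b.1).flatten := by
    rw [letters_spell, letters_spell, factors_of_context h₂]; simp
  have hred := (blockSystem_reduces_spell hf hXY).context hX hY
  rcases Relation.reflTransGen_iff_eq_or_transGen.1 hred with heq | htrans
  swap
  · exact .inl htrans
  refine .inr ⟨heq.symm, ?_⟩
  have hlen : (factors X).flatten.length = (factors Y).flatten.length := by
    rw [heq, hX] at hY
    simpa [letters_spell] using congrArg List.length hY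
  rw [factors_of_context h₁, factors_of_context h₂, List.append_assoc, List.append_assoc]
  apply suffixWeight_append_lt
  · simp [hlen]
  rcases hXY with ⟨-, hX', h⟩ | ⟨b, c, d, h, hs⟩ | ⟨b, c, d, e, h, hs, hlt⟩
  -- A rule of the first kind turns a reducible spelling into an irreducible one, so it cannot
  -- preserve the spelling.
  · obtain rfl : Y = f X := h
    refine absurd ?_ hX'
    rw [heq, hX] at hY
    have : letters (spell X) = letters (spell (f X)) := by simpa using hY
    rw [letters_injective this]
    exact hirr X
  · obtain ⟨rfl, rfl⟩ := Prod.mk.inj h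
    have := letters_length_pos c.1
    simp only [factors, letters_mul, letters_of, List.map_cons, List.map_nil,
      List.cons_append, List.nil_append, suffixWeight, List.flatten_cons, List.length_append]
    omega
  · obtain ⟨rfl, rfl⟩ := Prod.mk.inj h
    simp only [factors, letters_mul, letters_of, List.map_cons, List.map_nil,
      List.cons_append, List.nil_append, suffixWeight, List.flatten_cons, List.length_append]
    omega

theorem blockSystem_noetherian (hR : R.Noetherian)
    (hf : ∀ γ, R.Reduces (spell γ) (spell (f γ)))
    (hirr : ∀ γ, R.IsIrreducible (spell (f γ))) : (R.blockSystem n f).Noetherian := by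
  rw [noetherian_iff_wellFounded] at hR ⊢
  have hwf := WellFounded.prod_lex hR.transGen (Nat.lt_wfRel.wf)
  refine Subrelation.wf (fun {β' β} h => ?_)
    (InvImage.wf (fun β : FreeSemigroup B => (spell β, suffixWeight (factors β))) hwf)
  rcases blockSystem_step hf hirr h with h | ⟨h₁, h₂⟩
  · exact Prod.Lex.left _ _ (Relation.transGen_swap.2 h)
  · change Prod.Lex _ _ (spell β', _) (spell β, _)
    rw [h₁]
    exact Prod.Lex.right _ h₂

/-- If a word over `B` is irreducible, then so is the word it spells. -/
theorem IsIrreducible.spell_of_blockSystem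
    (hn : ∀ X Y, (X, Y) ∈ R → (letters X).length < n) {β : FreeSemigroup B}
    (hβ : (R.blockSystem n f).IsIrreducible β) : R.IsIrreducible (spell β) := by
  rintro v ⟨X, Y, hXY, Z₁, Z₂, h, -⟩
  rw [letters_spell] at h
  obtain ⟨P, C, Q, hPCQ, hC, hX⟩ := exists_short_infix_of_flatten_eq (factors β) (by
    intro l hl
    obtain ⟨b, -, rfl⟩ := mem_of_mem_factors hl
    exact letters_ne_nil _) Z₁ (letters X) Z₂ h
  obtain ⟨P', Q', hβ', hP, hQ⟩ := List.map_eq_append_iff.1 hPCQ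
  obtain ⟨P', C', rfl, rfl, rfl⟩ := List.map_eq_append_iff.1 hP
  obtain ⟨γ, rfl⟩ : ∃ γ, letters γ = C' := exists_letters_eq (by
    rintro rfl
    exact letters_ne_nil X (by simpa using hX))
  have hγ : ¬ R.IsIrreducible (spell γ) := fun hirr =>
    hirr.of_infix (v := X) (by rw [letters_spell]; exact hX) Y (step_of_mem hXY)
  -- At most `(letters X).length + 1 ≤ n` letters of `β` cover `X`, so a rule of the first kind
  -- applies to `γ`.
  have hn' := hn X Y hXY
  rw [List.length_map] at hC
  exact hβ.of_infix ⟨P', Q', hβ'.symm⟩ (f γ)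
    (step_of_mem (.inl ⟨by change (letters γ).length ≤ n; omega, hγ, rfl⟩))

end RewritingSystem

end Blocks

/-! ### Blocks for a subsemigroup with finite complement. -/

section LargeSubsemigroup

variable {S : Type*} [Semigroup S]

/-- The irreducible words of length at most `2 * K` that represent elements of `T`. -/
def blocks (R : RewritingSystem α) (φ : FreeSemigroup α →ₙ* S) (T : Subsemigroup S) (K : ℕ) :
    Set (FreeSemigroup α) :=
  {u | R.IsIrreducible u ∧ φ u ∈ T ∧ (letters u).length ≤ 2 * K}

variable {R : RewritingSystem α} {φ : FreeSemigroup α →ₙ* S} {T : Subsemigroup S} {K n : ℕ}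

instance [Finite α] : Finite (blocks R φ T K) :=
  ((finite_setOf_letters_length_le (2 * K)).subset fun _ h => h.2.2).to_subtype

/-- The evaluation of words over the blocks in `T`. -/
def blockEval : FreeSemigroup (blocks R φ T K) →ₙ* T :=
  FreeSemigroup.lift fun b => ⟨φ b.1, b.2.2.1⟩

theorem coe_blockEval (β : FreeSemigroup (blocks R φ T K)) :
    (blockEval β : S) = φ (spell β) := by
  induction β using FreeSemigroup.recOnMul with
  | ih1 b => simp [blockEval, spell_of]
  | ih2 b β h₁ h₂ => rw [map_mul, map_mul, map_mul, MulMemClass.coe_mul, h₁, h₂]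

theorem exists_letters_mul_eq {l₁ l₂ : List α} (h₁ : 0 < l₁.length) (h₂ : 0 < l₂.length)
    {w : FreeSemigroup α} (h : letters w = l₁ ++ l₂) :
    ∃ u v, letters u = l₁ ∧ letters v = l₂ ∧ w = u * v := by
  obtain ⟨u, rfl⟩ := exists_letters_eq (List.length_pos_iff.1 h₁)
  obtain ⟨v, rfl⟩ := exists_letters_eq (List.length_pos_iff.1 h₂)
  exact ⟨u, v, rfl, rfl, letters_injective (by rw [h, letters_mul])⟩

/-- A word of length greater than `k` splits after its first `k` letters. -/
theorem exists_mul_eq_of_lt_length {w : FreeSemigroup α} {k : ℕ} (hk : 0 < k)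
    (h : k < (letters w).length) :
    ∃ u v, (letters u).length = k ∧ (letters v).length = (letters w).length - k ∧ w = u * v := by
  obtain ⟨u, v, hu, hv, rfl⟩ := exists_letters_mul_eq (l₁ := (letters w).take k)
    (l₂ := (letters w).drop k) (w := w) (by simp; omega) (by simp; omega) (by simp)
  exact ⟨u, v, by rw [hu, List.length_take]; omega, by rw [hv, List.length_drop], rfl⟩

theorem RewritingSystem.IsIrreducible.left {u v : FreeSemigroup α}
    (h : R.IsIrreducible (u * v)) : R.IsIrreducible u :=
  h.of_infix (by rw [letters_mul]; exact (List.prefix_append _ _).isInfix)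

theorem RewritingSystem.IsIrreducible.right {u v : FreeSemigroup α}
    (h : R.IsIrreducible (u * v)) : R.IsIrreducible v :=
  h.of_infix (by rw [letters_mul]; exact (List.suffix_append _ _).isInfix)

/-- Every irreducible word that represents an element of `T` is spelled by blocks. -/
theorem exists_spell_eq (hK : 0 < K)
    (hlong : ∀ u, R.IsIrreducible u → K ≤ (letters u).length → φ u ∈ T)
    {w : FreeSemigroup α} (hw : R.IsIrreducible w) (hT : φ w ∈ T) :
    ∃ β : FreeSemigroup (blocks R φ T K), spell β = w := by
  induction hm : (letters w).length using Nat.strong_induction_on generalizing w with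
  | _ m ih =>
    rcases le_or_gt (letters w).length (2 * K) with h | h
    · exact ⟨FreeSemigroup.of ⟨w, hw, hT, h⟩, spell_of _⟩
    -- Both parts have length at least `K`, so both represent elements of `T`.
    · obtain ⟨u, v, hu, hv, rfl⟩ := exists_mul_eq_of_lt_length (w := w) hK (by omega)
      obtain ⟨β, hβ⟩ := ih _ (by omega) hw.right (hlong v hw.right (by omega)) rfl
      have hub : u ∈ blocks R φ T K := ⟨hw.left, hlong u hw.left hu.ge, by omega⟩
      exact ⟨FreeSemigroup.of ⟨u, hub⟩ * β, by rw [map_mul, spell_of, hβ]⟩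

theorem adjacent_of_isIrreducible (hK : 0 < K)
    (hlong : ∀ u, R.IsIrreducible u → K ≤ (letters u).length → φ u ∈ T)
    {f : FreeSemigroup (blocks R φ T K) → FreeSemigroup (blocks R φ T K)}
    {b c : blocks R φ T K} (hbc : R.IsIrreducible (b.1 * c.1))
    (hirr : (R.blockSystem n f).IsIrreducible (FreeSemigroup.of b * FreeSemigroup.of c)) :
    Adjacent (letters '' blocks R φ T K) K (letters b.1) (letters c.1) := by
  have hb := b.2.2.2
  have hc := c.2.2.2
  have hT : φ (b.1 * c.1) ∈ T := by
    rw [map_mul]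
    exact T.mul_mem b.2.2.1 c.2.2.1
  have hlen : (letters (b.1 * c.1)).length = (letters b.1).length + (letters c.1).length := by
    rw [letters_mul, List.length_append]
  have hshift (d e : blocks R φ T K) (h : b.1 * c.1 = d.1 * e.1) :
      (letters c.1).length ≤ (letters e.1).length := by
    by_contra! hlt
    exact hirr _ (RewritingSystem.step_of_mem (.inr (.inr ⟨b, c, d, e, rfl, h, hlt⟩)))
  have hsum : 2 * K < (letters b.1).length + (letters c.1).length := by
    by_contra! h
    exact hirr _ (RewritingSystem.step_of_mem
      (.inr (.inl ⟨b, c, ⟨b.1 * c.1, hbc, hT, hlen ▸ h⟩, rfl, rfl⟩)))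
  refine ⟨hsum, ?_, ?_⟩
  · by_contra! h
    obtain ⟨hb', hc'⟩ := h
    -- The cut is as far right as possible with `u` of length at most `2 * K` and `v` of length at
    -- least `K`. Both parts are blocks, and `v` is shorter than `c`, so a shift would apply.
    obtain ⟨u, v, hu, hv, huv⟩ := exists_mul_eq_of_lt_length (w := b.1 * c.1)
      (k := min (2 * K) ((letters b.1).length + (letters c.1).length - K)) (by omega) (by omega)
    rw [huv] at hbc
    have := hshift ⟨u, hbc.left, hlong u hbc.left (by omega), by omega⟩
      ⟨v, hbc.right, hlong v hbc.right (by omega), by omega⟩ huv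
    simp only at this
    omega
  · rintro _ ⟨d, hd, rfl⟩ _ ⟨e, he, rfl⟩ h
    rw [← letters_mul, ← letters_mul] at h
    exact hshift ⟨d, hd⟩ ⟨e, he⟩ (letters_injective h)

theorem isChain_factors (hK : 0 < K)
    (hlong : ∀ u, R.IsIrreducible u → K ≤ (letters u).length → φ u ∈ T)
    {f : FreeSemigroup (blocks R φ T K) → FreeSemigroup (blocks R φ T K)}
    {β : FreeSemigroup (blocks R φ T K)} (hβ : R.IsIrreducible (spell β))
    (hirr : (R.blockSystem n f).IsIrreducible β) :
    (factors β).IsChain (Adjacent (letters '' blocks R φ T K) K) := by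
  rw [factors, List.isChain_map, List.isChain_iff_forall_rel_of_append_cons_cons]
  intro b c P Q h
  have h' : letters β = P ++ letters (FreeSemigroup.of b * FreeSemigroup.of c) ++ Q := by
    simp [h, letters_mul, letters_of]
  refine adjacent_of_isIrreducible hK hlong (n := n) (f := f) ?_ (hirr.of_infix ⟨P, Q, h'.symm⟩)
  refine hβ.of_infix ?_
  rw [letters_spell, factors_of_context h', ← spell_of b, ← spell_of c, ← map_mul, letters_spell,
    List.flatten_append, List.flatten_append]
  exact List.infix_append _ _ _

/-- Irreducible words are determined by the word that they spell. -/
theorem eq_of_spell_eq (hK : 0 < K)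
    (hlong : ∀ u, R.IsIrreducible u → K ≤ (letters u).length → φ u ∈ T)
    {f : FreeSemigroup (blocks R φ T K) → FreeSemigroup (blocks R φ T K)}
    {β γ : FreeSemigroup (blocks R φ T K)} (hβ : R.IsIrreducible (spell β))
    (hirrβ : (R.blockSystem n f).IsIrreducible β) (hirrγ : (R.blockSystem n f).IsIrreducible γ)
    (h : spell β = spell γ) : β = γ := by
  apply factors_injective
  refine eq_of_flatten_eq_of_isChain (D := letters '' blocks R φ T K) (K := K) ?_ ?_ ?_
    (isChain_factors hK hlong hβ hirrβ) (isChain_factors hK hlong (h ▸ hβ) hirrγ) ?_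
  · rintro _ ⟨u, hu, rfl⟩
    exact ⟨letters_length_pos u, hu.2.2⟩
  · intro l hl
    obtain ⟨b, -, rfl⟩ := mem_of_mem_factors hl
    exact ⟨b, b.2, rfl⟩
  · intro l hl
    obtain ⟨b, -, rfl⟩ := mem_of_mem_factors hl
    exact ⟨b, b.2, rfl⟩
  · rw [← letters_spell, ← letters_spell, h]

/-- If only finitely many elements lie outside `T`, then all sufficiently long irreducible words
represent elements of `T`. -/
theorem exists_length_bound (hinj : Set.InjOn φ {u | R.IsIrreducible u})
    (hT : ((T : Set S)ᶜ).Finite) :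
    ∃ K, 0 < K ∧ ∀ u, R.IsIrreducible u → K ≤ (letters u).length → φ u ∈ T := by
  have hfin : {u | R.IsIrreducible u ∧ φ u ∉ T}.Finite :=
    Set.Finite.of_finite_image (f := φ) (hT.subset (by rintro _ ⟨u, hu, rfl⟩; exact hu.2))
      (hinj.mono fun u hu => hu.1)
  obtain ⟨N, hN⟩ := (hfin.image fun u => (letters u).length).bddAbove
  refine ⟨N + 1, N.succ_pos, fun u hu hlen => ?_⟩
  by_contra h
  have := hN ⟨u, ⟨hu, h⟩, rfl⟩
  simp only at this
  omega

end LargeSubsemigroup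

end StringRewriting

/-! ### The main theorem. -/

open StringRewriting

theorem theorem1p1 {S : Type*} [Semigroup S] (T : Subsemigroup S)
    (hT : ((T : Set S)ᶜ).Finite)
    (hS : StringRewriting.HasFiniteCompleteRewritingSystem S) :
    StringRewriting.HasFiniteCompleteRewritingSystem T := by
  obtain ⟨A, R, hA, hfin, ⟨hnoeth, hconf⟩, hpres⟩ := hS
  obtain ⟨φ, hsurj, hrel, hinj⟩ := hpres.exists_evaluation hconf
  obtain ⟨K, hK, hlong⟩ := exists_length_bound hinj hT
  obtain ⟨N, hN⟩ := (hfin.image fun p => (letters p.1).length).bddAbove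
  have hn (X Y : FreeSemigroup A) (h : (X, Y) ∈ R) : (letters X).length < N + 1 :=
    Nat.lt_succ_of_le (hN ⟨(X, Y), h, rfl⟩)
  -- Reduction preserves the value, so the normal form of a spelled word stays in `T` and is again
  -- spelled by blocks.
  have hex (γ : FreeSemigroup (blocks R φ T K)) : ∃ δ : FreeSemigroup (blocks R φ T K),
      R.Reduces (spell γ) (spell δ) ∧ R.IsIrreducible (spell δ) := by
    obtain ⟨w, hγw, hw⟩ := hnoeth.exists_irreducible (spell γ)
    obtain ⟨δ, rfl⟩ := exists_spell_eq hK hlong hw (by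
      rw [← RewritingSystem.map_eq_of_reduces hrel hγw, ← coe_blockEval]
      exact (blockEval γ).2)
    exact ⟨δ, hγw, hw⟩
  choose f hf hirr using hex
  refine ⟨blocks R φ T K, R.blockSystem (N + 1) f, inferInstance,
    RewritingSystem.blockSystem_finite,
    (RewritingSystem.blockSystem_noetherian hnoeth hf hirr).complete_and_presents
      (φ := blockEval) ?_ ?_ ?_⟩
  · rintro ⟨t, ht⟩
    obtain ⟨u, rfl⟩ := hsurj t
    obtain ⟨w, huw, hw⟩ := hnoeth.exists_irreducible u
    have hφ := RewritingSystem.map_eq_of_reduces hrel huw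
    obtain ⟨β, rfl⟩ := exists_spell_eq hK hlong hw (hφ ▸ ht)
    exact ⟨β, Subtype.ext ((coe_blockEval β).trans hφ.symm)⟩
  · intro X Y hXY
    apply Subtype.ext
    rw [coe_blockEval, coe_blockEval]
    exact RewritingSystem.map_eq_of_reduces hrel
      (RewritingSystem.blockSystem_reduces_spell hf hXY)
  · intro β hβ γ hγ h
    have hβ' := RewritingSystem.IsIrreducible.spell_of_blockSystem hn hβ
    refine eq_of_spell_eq hK hlong hβ' hβ hγ (hinj hβ'
      (RewritingSystem.IsIrreducible.spell_of_blockSystem hn hγ) ?_)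
    rw [← coe_blockEval, ← coe_blockEval, h]
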